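/- For $n\ge 1$ let $Q_n$ be the graph with vertex set $\{(x,y,z)\in\mathbb{Z}^3 : 0\le x,y,z\le n-1\}$ in which two distinct vertices are adjacent if and only if, for one of the two ways of naming them $(x,y,z)$ and $(x',y',z')$, we have $x\le x'\le x+1$, $y\le y'\le y+1$ and $z\le z'\le z+1$. Write $\mathrm{tw}(G)$ for the tree-width of a finite graph $G$, that is, the minimum over all tree decompositions of $G$ of the maximum size of a bag minus one. A class $\mathcal{G}$ of finite graphs is called *tree-width fragile* if for every $k\ge 1$ there exists an integer $t_k\ge 0$ such that for every $G\in\mathcal{G}$ there are pairwise disjoint sets $A_1,\dots,A_k\subseteq V(G)$ with $\mathrm{tw}(G-A_i)\le t_k$ for all $1\le i\le k$. The class $\{Q_n : n\ge 1\}$ is not tree-width fragile. The condition fails already for $k=2$: no $t_2$ as above exists. More precisely, for every integer $t\ge 0$ there is $N$ such that for every $n\ge N$ there are no two disjoint sets $A_1,A_2\subseteq V(Q_n)$ with $\mathrm{tw}(Q_n-A_1)\le t$ and $\mathrm{tw}(Q_n-A_2)\le t$. -/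

import Mathlib

/-- A tree decomposition of a graph `G`: a finite tree whose nodes carry bags of vertices of `G`,
such that every vertex and both ends of every edge lie in a common bag, and the nodes whose bags
contain a given vertex induce a connected (in particular nonempty) subtree. -/
structure TreeDecomposition {V : Type} (G : SimpleGraph V) where
  Node : Type
  [fintypeNode : Fintype Node]
  tree : SimpleGraph Node
  isTree : tree.IsTree
  bag : Node → Set V
  vertex_mem : ∀ v : V, ∃ u : Node, v ∈ bag u
  edge_mem : ∀ v w : V, G.Adj v w → ∃ u : Node, v ∈ bag u ∧ w ∈ bag u
  connected : ∀ v : V, (tree.induce {u : Node | v ∈ bag u}).Connected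

attribute [instance] TreeDecomposition.fintypeNode

/-- The maximum size of a bag, minus one (an integer, so that the value `-1` is possible for
a graph without vertices). Used only for graphs with finitely many vertices. -/
noncomputable def TreeDecomposition.width {V : Type} {G : SimpleGraph V}
    (D : TreeDecomposition G) : ℤ :=
  ((Finset.univ.sup fun u : D.Node => (D.bag u).ncard : ℕ) : ℤ) - 1

/-- The minimum width of a tree decomposition of a finite graph. -/
noncomputable def treewidth {V : Type} [Finite V] (G : SimpleGraph V) : ℤ :=
  sInf (Set.range fun D : TreeDecomposition G => D.width)

/-- The decomposition with a single bag. -/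
def TreeDecomposition.trivial {V : Type} (G : SimpleGraph V) : TreeDecomposition G where
  Node := Unit
  tree := ⊥
  isTree := SimpleGraph.IsTree.of_subsingleton
  bag := fun _ => Set.univ
  vertex_mem := fun _ => ⟨(), Set.mem_univ _⟩
  edge_mem := fun _ _ _ => ⟨(), Set.mem_univ _, Set.mem_univ _⟩
  connected := fun v =>
    haveI : Nonempty {u : Unit | v ∈ (fun _ : Unit => (Set.univ : Set V)) u} :=
      ⟨⟨(), Set.mem_univ v⟩⟩
    ⟨SimpleGraph.Preconnected.of_subsingleton⟩

/-- The infimum in the definition of tree-width is a minimum. -/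
theorem treewidth_mem_range {V : Type} [Finite V] (G : SimpleGraph V) :
    ∃ D : TreeDecomposition G, D.width = treewidth G := by
  have h : treewidth G ∈ Set.range fun D : TreeDecomposition G => D.width := by
    refine Int.csInf_mem ⟨_, ⟨TreeDecomposition.trivial G, rfl⟩⟩ ⟨-1, ?_⟩
    rintro _ ⟨D, rfl⟩
    simp only [TreeDecomposition.width]
    omega
  exact h

theorem treewidth_le_iff {V : Type} [Finite V] (G : SimpleGraph V) (t : ℤ) :
    treewidth G ≤ t ↔ ∃ D : TreeDecomposition G, D.width ≤ t := by
  constructor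
  · intro h
    obtain ⟨D, hD⟩ := treewidth_mem_range G
    exact ⟨D, hD.le.trans h⟩
  · rintro ⟨D, hD⟩
    refine (csInf_le ⟨-1, ?_⟩ (Set.mem_range_self D)).trans hD
    rintro _ ⟨D, rfl⟩
    simp only [TreeDecomposition.width]
    omega

/-- A class of finite graphs. -/
def GraphClass : Type 1 := ∀ (V : Type) [Finite V], SimpleGraph V → Prop

/-- The condition of tree-width fragility for a fixed number `k` of sets: for some bound `t`,
every graph `G` of the class has pairwise disjoint vertex sets `A 1, …, A k` such that each
`G - A i` has tree-width at most `t`. -/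
def TreewidthFragileFor (𝒢 : GraphClass) (k : ℕ) : Prop :=
  ∃ t : ℕ, ∀ (V : Type) [Finite V] (G : SimpleGraph V), 𝒢 V G →
    ∃ A : Fin k → Set V, (∀ i j : Fin k, i ≠ j → Disjoint (A i) (A j)) ∧
      ∀ i : Fin k, treewidth (G.induce (A i)ᶜ) ≤ (t : ℤ)

/-- Tree-width fragile classes of graphs. -/
def TreewidthFragile (𝒢 : GraphClass) : Prop :=
  ∀ k : ℕ, 1 ≤ k → TreewidthFragileFor 𝒢 k

/-- The `n × n × n` grid with all non-decreasing diagonals in its unit cubes: distinct vertices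
`p`, `q` are adjacent when, in one of the two orders, every coordinate stays the same or
increases by one. -/
def diagonalCubeGrid (n : ℕ) : SimpleGraph (Fin n × Fin n × Fin n) :=
  SimpleGraph.fromRel fun p q =>
    ((p.1 : ℕ) ≤ (q.1 : ℕ) ∧ (q.1 : ℕ) ≤ (p.1 : ℕ) + 1) ∧
    ((p.2.1 : ℕ) ≤ (q.2.1 : ℕ) ∧ (q.2.1 : ℕ) ≤ (p.2.1 : ℕ) + 1) ∧
    ((p.2.2 : ℕ) ≤ (q.2.2 : ℕ) ∧ (q.2.2 : ℕ) ≤ (p.2.2 : ℕ) + 1)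

/-- The class of the graphs `diagonalCubeGrid n` with `n ≥ 1`, up to isomorphism. -/
def diagonalCubeGridClass : GraphClass := fun _ _ G =>
  ∃ n : ℕ, 1 ≤ n ∧ Nonempty (G ≃g diagonalCubeGrid n)

open Finset

/-! Put B = A₁ᶜ and B' = A₁ ⊆ A₂ᶜ. If the claim failed, both parts of this partition would lie in
sets with tree decompositions of small width. The contradiction is a parity count.

For darts a, b of the two trees, mark the grid edges joining the points of B behind a to the points
of B' behind b. Away from the two bags this is a cocycle mod 2 (`crossing_additive`). Deleting fewer
than n points leaves so much of the grid that it is there the coboundary of a potential g a b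
(`exists_potential`).

A cell is a node or an edge of a tree. Off its bag, the sides of the darts at a cell c of the first
tree add up to the indicator of B. Hence ∑ₐ g a b has the same coboundary as the side of b, and
equals that side plus a constant l c b (`exists_sum_potential_eq`). Symmetrically, summing over the
darts at c' leaves a constant m c' a. Computing the double sum of g at one point both ways gives ∑ l
+ ∑ m = 1_B + 1_B' = 1 for every pair (c, c').

Now sum over all pairs. Each tree has an odd number of cells, so the right side gives 1. Each dart
lies in exactly two cells, so the left side gives 0 (`false_of_compl`). -/

theorem zmod_two_two : (2 : ZMod 2) = 0 := rfl

/-! ### Connectivity of the grid after deleting few points -/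

/-- Vertices of the `n × n × n` grid. -/
abbrev GridPoint (n : ℕ) : Type := Fin n × Fin n × Fin n

/-- Every coordinate stays the same or increases by one. -/
def Ascends {n : ℕ} (p q : GridPoint n) : Prop :=
  ((p.1 : ℕ) ≤ (q.1 : ℕ) ∧ (q.1 : ℕ) ≤ (p.1 : ℕ) + 1) ∧
  ((p.2.1 : ℕ) ≤ (q.2.1 : ℕ) ∧ (q.2.1 : ℕ) ≤ (p.2.1 : ℕ) + 1) ∧
  ((p.2.2 : ℕ) ≤ (q.2.2 : ℕ) ∧ (q.2.2 : ℕ) ≤ (p.2.2 : ℕ) + 1)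

/-- Exactly one coordinate increases by one and the others stay the same. -/
def AxisStep {n : ℕ} (p q : GridPoint n) : Prop :=
  ((p.1 : ℕ) + 1 = q.1 ∧ p.2.1 = q.2.1 ∧ p.2.2 = q.2.2) ∨
  (p.1 = q.1 ∧ (p.2.1 : ℕ) + 1 = q.2.1 ∧ p.2.2 = q.2.2) ∨
  (p.1 = q.1 ∧ p.2.1 = q.2.1 ∧ (p.2.2 : ℕ) + 1 = q.2.2)

theorem AxisStep.ascends {n : ℕ} {p q : GridPoint n} (h : AxisStep p q) : Ascends p q := by
  obtain ⟨x, y, z⟩ := p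
  obtain ⟨x', y', z'⟩ := q
  simp only [AxisStep, Ascends, Fin.ext_iff] at *
  omega

/-- The points whose first or whose second coordinate does not occur in `Z`. -/
def freePoints {n : ℕ} (Z : Set (GridPoint n)) : Set (GridPoint n) :=
  {p | (∀ q ∈ Z, q.1 ≠ p.1) ∨ ∀ q ∈ Z, q.2.1 ≠ p.2.1}

theorem freePoints_anti {n : ℕ} {Z Z' : Set (GridPoint n)} (h : Z ⊆ Z') :
    freePoints Z' ⊆ freePoints Z := by
  rintro p (hp | hp)
  · exact Or.inl fun q hq => hp q (h hq)
  · exact Or.inr fun q hq => hp q (h hq)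

theorem notMem_of_mem_freePoints {n : ℕ} {Z : Set (GridPoint n)} {p : GridPoint n}
    (hp : p ∈ freePoints Z) : p ∉ Z := fun h => by
  rcases hp with hp | hp <;> exact hp p h rfl

theorem exists_unused_coordinate {n : ℕ} {Z : Set (GridPoint n)} (hZ : Z.ncard < n)
    (c : GridPoint n → Fin n) : ∃ x : Fin n, ∀ q ∈ Z, c q ≠ x := by
  by_contra! h
  have h1 : c '' Z = Set.univ := Set.eq_univ_of_forall h
  have h2 := Set.ncard_image_le (f := c) Z.toFinite
  rw [h1, Set.ncard_univ, Nat.card_eq_fintype_card, Fintype.card_fin] at h2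
  omega

theorem eq_of_forall_succ {n : ℕ} {F : Type*} (f : Fin n → F)
    (h : ∀ i j : Fin n, (i : ℕ) + 1 = j → f i = f j) (i j : Fin n) : f i = f j := by
  have key : ∀ (m : ℕ) (hm : m < n), f ⟨m, hm⟩ = f ⟨0, by omega⟩ := by
    intro m
    induction m with
    | zero => intro _; rfl
    | succ m ih => intro hm; rw [← ih (by omega)]; exact (h _ _ rfl).symm
  rw [key i i.2, key j j.2]

/-- The free points are connected by axis-parallel steps. -/
theorem eq_of_forall_axisStep {n : ℕ} {Z : Set (GridPoint n)} (hZ : Z.ncard < n) {F : Type*}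
    (f : GridPoint n → F)
    (h : ∀ p ∈ freePoints Z, ∀ q ∈ freePoints Z, AxisStep p q → f p = f q) :
    ∃ c, ∀ p ∈ freePoints Z, f p = c := by
  obtain ⟨x₀, hx₀⟩ := exists_unused_coordinate hZ fun q => q.1
  obtain ⟨y₀, hy₀⟩ := exists_unused_coordinate hZ fun q => q.2.1
  have hX : ∀ x : Fin n, (∀ q ∈ Z, q.1 ≠ x) → ∀ y z y' z', f (x, y, z) = f (x, y', z') := by
    intro x hx y z y' z'
    have h1 := eq_of_forall_succ (fun i => f (x, i, z)) (fun i j hij =>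
      h _ (Or.inl hx) _ (Or.inl hx) (Or.inr (Or.inl ⟨rfl, hij, rfl⟩))) y y'
    have h2 := eq_of_forall_succ (fun i => f (x, y', i)) (fun i j hij =>
      h _ (Or.inl hx) _ (Or.inl hx) (Or.inr (Or.inr ⟨rfl, rfl, hij⟩))) z z'
    exact h1.trans h2
  have hY : ∀ y : Fin n, (∀ q ∈ Z, q.2.1 ≠ y) → ∀ x z x' z', f (x, y, z) = f (x', y, z') := by
    intro y hy x z x' z'
    have h1 := eq_of_forall_succ (fun i => f (i, y, z)) (fun i j hij =>
      h _ (Or.inr hy) _ (Or.inr hy) (Or.inl ⟨hij, rfl, rfl⟩)) x x'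
    have h2 := eq_of_forall_succ (fun i => f (x', y, i)) (fun i j hij =>
      h _ (Or.inr hy) _ (Or.inr hy) (Or.inr (Or.inr ⟨rfl, rfl, hij⟩))) z z'
    exact h1.trans h2
  -- The planes x = x₀ and y = y₀ avoid `Z` and meet, and any other free plane meets one of them.
  -- The third coordinate is arbitrary.
  refine ⟨f (x₀, y₀, x₀), ?_⟩
  rintro ⟨x, y, z⟩ (hp | hp)
  · exact (hX x hp y z y₀ z).trans (hY y₀ hy₀ _ _ _ _)
  · exact (hY y hp x z x₀ z).trans (hX x₀ hx₀ _ _ _ _)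

theorem freePoints_nonempty {n : ℕ} {Z : Set (GridPoint n)} (hZ : Z.ncard < n) :
    (freePoints Z).Nonempty := by
  obtain ⟨x₀, hx₀⟩ := exists_unused_coordinate hZ fun q => q.1
  exact ⟨(x₀, x₀, x₀), Or.inl hx₀⟩

/-! ### Integrating a cocycle mod 2 -/

/-- A function on pairs that is additive along chains outside `Z` is a coboundary on the
free points. -/
theorem exists_potential {n : ℕ} {Z : Set (GridPoint n)} (hZ : Z.ncard < n)
    (h : GridPoint n → GridPoint n → ZMod 2)
    (hc : ∀ p q s, p ∉ Z → q ∉ Z → s ∉ Z → Ascends p q → Ascends q s → Ascends p s →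
      h p q + h q s = h p s) :
    ∃ g : GridPoint n → ZMod 2, ∀ p ∈ freePoints Z, ∀ q ∈ freePoints Z, AxisStep p q →
      g p + g q = h p q := by
  have two := zmod_two_two
  obtain ⟨z₀, hz₀⟩ := exists_unused_coordinate hZ fun q => q.2.2
  have : NeZero n := ⟨by omega⟩
  let P : ℕ → ℕ → ℕ → GridPoint n := fun x y z => (Fin.ofNat n x, Fin.ofNat n y, Fin.ofNat n z)
  have hP : ∀ p : GridPoint n, P p.1 p.2.1 p.2.2 = p := fun p => by simp [P]
  have asc : ∀ x y z x' y' z' : ℕ, x' < n → y' < n → z' < n → x ≤ x' → x' ≤ x + 1 → y ≤ y' →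
      y' ≤ y + 1 → z ≤ z' → z' ≤ z + 1 → Ascends (P x y z) (P x' y' z') := by
    intro x y z x' y' z' hx' hy' hz' h1 h2 h3 h4 h5 h6
    simp only [Ascends, P, Fin.ofNat, Nat.mod_eq_of_lt hx', Nat.mod_eq_of_lt hy',
      Nat.mod_eq_of_lt hz', Nat.mod_eq_of_lt (h1.trans_lt hx'), Nat.mod_eq_of_lt (h3.trans_lt hy'),
      Nat.mod_eq_of_lt (h5.trans_lt hz')]
    omega
  -- parallel edges of a unit square
  have square : ∀ p q r s, p ∉ Z → q ∉ Z → r ∉ Z → s ∉ Z → Ascends p q → Ascends p r →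
      Ascends q s → Ascends r s → Ascends p s → h p q + h r s = h p r + h q s := by
    intro p q r s hp hq hr hs h1 h2 h3 h4 h5
    linear_combination hc p q s hp hq hs h1 h3 h5 - hc p r s hp hr hs h2 h4 h5
      + (h r s - h q s) * two
  -- Integrate inside the level z₀, which misses `Z`: along x first, then along y.
  let φ : ℕ → ℕ → ZMod 2 := fun x y =>
    (∑ i ∈ range x, h (P i 0 z₀) (P (i + 1) 0 z₀)) + ∑ j ∈ range y, h (P x j z₀) (P x (j + 1) z₀)
  let C : ℕ → ℕ → ℕ → ZMod 2 := fun x y z => ∑ k ∈ range z, h (P x y k) (P x y (k + 1))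
  have hz : ∀ x y, P x y z₀ ∉ Z := fun x y hm => hz₀ _ hm (by simp [P])
  have hφy : ∀ x y, φ x y + φ x (y + 1) = h (P x y z₀) (P x (y + 1) z₀) := by
    intro x y
    simp only [φ, sum_range_succ]
    linear_combination ((∑ i ∈ range x, h (P i 0 z₀) (P (i + 1) 0 z₀)) +
      ∑ j ∈ range y, h (P x j z₀) (P x (j + 1) z₀)) * two
  have hφx : ∀ x y, x + 1 < n → y < n →
      φ x y + φ (x + 1) y = h (P x y z₀) (P (x + 1) y z₀) := by
    intro x y hx
    induction y with
    | zero =>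
      intro _
      simp only [φ, sum_range_succ, sum_range_zero]
      linear_combination (∑ i ∈ range x, h (P i 0 z₀) (P (i + 1) 0 z₀)) * two
    | succ y ih =>
      intro hy
      have h1 := ih (by omega)
      have h2 := hφy x y
      have h3 := hφy (x + 1) y
      have hz' := z₀.2
      have h4 := square _ _ _ _ (hz x y) (hz x (y + 1)) (hz (x + 1) y) (hz (x + 1) (y + 1))
        (by apply asc <;> omega) (by apply asc <;> omega) (by apply asc <;> omega)
        (by apply asc <;> omega) (by apply asc <;> omega)
      linear_combination h1 + h2 + h3 + h4 - (φ x y + φ (x + 1) y) * two +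
        (h (P x y z₀) (P (x + 1) y z₀)) * two
  -- Climb the ladder between two neighbouring columns, one unit square at a time.
  have hC : ∀ x y x' y' : ℕ, x' < n → y' < n → x ≤ x' → x' ≤ x + 1 → y ≤ y' → y' ≤ y + 1 →
      (∀ k, P x y k ∉ Z) → (∀ k, P x' y' k ∉ Z) → ∀ z, z < n →
      C x y z + C x' y' z = h (P x y 0) (P x' y' 0) + h (P x y z) (P x' y' z) := by
    intro x y x' y' hx' hy' h1 h2 h3 h4 hk hk' z
    induction z with
    | zero =>
      intro _
      simp only [C, sum_range_zero]
      linear_combination - h (P x y 0) (P x' y' 0) * two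
    | succ z ih =>
      intro hz
      have e1 := ih (by omega)
      have e2 := square _ _ _ _ (hk z) (hk (z + 1)) (hk' z) (hk' (z + 1))
        (by apply asc <;> omega) (by apply asc <;> omega) (by apply asc <;> omega)
        (by apply asc <;> omega) (by apply asc <;> omega)
      simp only [C, sum_range_succ] at e1 ⊢
      linear_combination e1 + e2 + h (P x y z) (P x' y' z) * two
  -- Freeness does not depend on the third coordinate, so the whole column of a free point avoids
  -- `Z`.
  have column : ∀ x y z, P x y z ∈ freePoints Z → ∀ k, P x y k ∉ Z := by
    intro x y z hm k
    exact notMem_of_mem_freePoints (Z := Z) (p := P x y k) hm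
  have horizontal : ∀ x y x' y' z : ℕ, x' < n → y' < n → z < n → x ≤ x' → x' ≤ x + 1 → y ≤ y' →
      y' ≤ y + 1 → P x y z ∈ freePoints Z → P x' y' z ∈ freePoints Z →
      φ x y + φ x' y' = h (P x y z₀) (P x' y' z₀) →
      (φ x y + C x y z + C x y z₀) + (φ x' y' + C x' y' z + C x' y' z₀) =
        h (P x y z) (P x' y' z) := by
    intro x y x' y' z hx' hy' hz' h1 h2 h3 h4 hf hf' hφ
    have e1 := hC x y x' y' hx' hy' h1 h2 h3 h4 (column _ _ _ hf) (column _ _ _ hf') z hz'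
    have e2 := hC x y x' y' hx' hy' h1 h2 h3 h4 (column _ _ _ hf) (column _ _ _ hf') z₀ z₀.2
    linear_combination e1 + e2 + hφ + (h (P x y 0) (P x' y' 0) + h (P x y z₀) (P x' y' z₀)) * two
  -- Mod 2, the two `C` terms leave the integral over the column between levels z₀ and z.
  let g : GridPoint n → ZMod 2 := fun p => φ p.1 p.2.1 + C p.1 p.2.1 p.2.2 + C p.1 p.2.1 z₀
  refine ⟨g, ?_⟩
  intro p hp q hq hpq
  have ep := hP p
  have eq := hP q
  rcases hpq with ⟨hx, hy, hz⟩ | ⟨hx, hy, hz⟩ | ⟨hx, hy, hz⟩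
  · have hlt := q.1.2
    rw [← hx, ← hy, ← hz] at eq
    have := horizontal p.1 p.2.1 (p.1 + 1) p.2.1 p.2.2 (by omega) p.2.1.2 p.2.2.2 (by omega)
      (by omega) le_rfl (by omega) (by rwa [ep]) (by rwa [eq])
      (hφx _ _ (by omega) p.2.1.2)
    simp only [g, ← hx, ← hy, ← hz]
    rw [this, ep, eq]
  · have hlt := q.2.1.2
    rw [← hx, ← hy, ← hz] at eq
    have := horizontal p.1 p.2.1 p.1 (p.2.1 + 1) p.2.2 p.1.2 (by omega) p.2.2.2 le_rfl
      (by omega) (by omega) le_rfl (by rwa [ep]) (by rwa [eq]) (hφy _ _)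
    simp only [g, ← hx, ← hy, ← hz]
    rw [this, ep, eq]
  · rw [← hx, ← hy, ← hz] at eq
    simp only [g, ← hx, ← hy, ← hz, C, sum_range_succ]
    rw [ep, eq]
    linear_combination (φ p.1 p.2.1 + C p.1 p.2.1 p.2.2 + C p.1 p.2.1 z₀) * two

/-! ### Splittings and the parity argument -/

/-- The incidence structure of a tree decomposition of the part `B` of the grid: the cells are
nodes and edges, the arcs are the orientations of edges, and `side a` indicates the vertices
of `B` that lie behind the arc `a`. -/
structure Splitting {n : ℕ} (B : Set (GridPoint n)) (k : ℕ) where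
  Cell : Type
  Arc : Type
  [fintypeCell : Fintype Cell]
  [fintypeArc : Fintype Arc]
  arcs : Cell → Finset Arc
  -- A tree with e edges has e + 1 nodes, hence 2e + 1 cells.
  odd_card : (Fintype.card Cell : ZMod 2) = 1
  -- Each arc occurs at two cells: its tail and its underlying edge.
  even_incidence : ∀ f : Arc → ZMod 2, ∑ c, ∑ a ∈ arcs c, f a = 0
  cellBag : Cell → Set (GridPoint n)
  arcBag : Arc → Set (GridPoint n)
  ncard_cellBag_le : ∀ c, (cellBag c).ncard ≤ k
  ncard_arcBag_le : ∀ a, (arcBag a).ncard ≤ k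
  arcBag_subset : ∀ c, ∀ a ∈ arcs c, arcBag a ⊆ cellBag c
  side : Arc → GridPoint n → ZMod 2
  side_eq_zero : ∀ a, ∀ p ∉ B, side a p = 0
  sum_side : ∀ c, ∀ p ∈ B, p ∉ cellBag c → ∑ a ∈ arcs c, side a p = 1
  side_congr : ∀ a, ∀ p ∈ B, ∀ q ∈ B, p ∉ arcBag a → q ∉ arcBag a → Ascends p q →
    side a p = side a q

attribute [instance] Splitting.fintypeCell Splitting.fintypeArc

namespace Splitting

variable {n k : ℕ} {B B' : Set (GridPoint n)}

/-- The sum over the grid edges between the two given sides is additive along chains. -/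
theorem crossing_additive (hB : ∀ p, p ∈ B' ↔ p ∉ B) (S : Splitting B k) (S' : Splitting B' k)
    (a : S.Arc) (b : S'.Arc) (p q s : GridPoint n) (hp : p ∉ S.arcBag a ∪ S'.arcBag b)
    (hq : q ∉ S.arcBag a ∪ S'.arcBag b) (hs : s ∉ S.arcBag a ∪ S'.arcBag b)
    (hpq : Ascends p q) (hqs : Ascends q s) (hps : Ascends p s) :
    (S.side a p * S'.side b q + S'.side b p * S.side a q) +
      (S.side a q * S'.side b s + S'.side b q * S.side a s) =
      S.side a p * S'.side b s + S'.side b p * S.side a s := by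
  have two := zmod_two_two
  simp only [Set.mem_union, not_or] at hp hq hs
  have zero' : ∀ r, r ∈ B → S'.side b r = 0 := fun r hr =>
    S'.side_eq_zero b r fun h => (hB r).1 h hr
  have zero : ∀ r, r ∉ B → S.side a r = 0 := fun r hr => S.side_eq_zero a r hr
  have c1 : ∀ r ∈ B, ∀ r' ∈ B, r ∉ S.arcBag a → r' ∉ S.arcBag a → Ascends r r' →
    S.side a r = S.side a r' := S.side_congr a
  have c2 : ∀ r, r ∉ B → ∀ r', r' ∉ B → r ∉ S'.arcBag b → r' ∉ S'.arcBag b → Ascends r r' →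
    S'.side b r = S'.side b r' := fun r hr r' hr' =>
      S'.side_congr b r ((hB r).2 hr) r' ((hB r').2 hr')
  -- Edges within one part contribute 0. If the part changes, two of the points share a part and
  -- hence a side, so the two edges to the third point contribute equally.
  by_cases mp : p ∈ B <;> by_cases mq : q ∈ B <;> by_cases ms : s ∈ B
  · rw [zero' p mp, zero' q mq, zero' s ms]; ring
  · rw [zero' p mp, zero' q mq, c1 p mp q mq hp.1 hq.1 hpq]; ring
  · rw [zero' p mp, zero' s ms, zero q mq, c1 p mp s ms hp.1 hs.1 hps]
    linear_combination (S.side a s * S'.side b q) * two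
  · rw [zero' p mp, zero q mq, zero s ms, c2 q mq s ms hq.2 hs.2 hqs]; ring
  · rw [zero p mp, zero' q mq, zero' s ms, c1 q mq s ms hq.1 hs.1 hqs]; ring
  · rw [zero p mp, zero s ms, zero' q mq, c2 p mp s ms hp.2 hs.2 hps]
    linear_combination (S.side a q * S'.side b s) * two
  · rw [zero p mp, zero q mq, zero' s ms, c2 p mp q mq hp.2 hq.2 hpq]; ring
  · rw [zero p mp, zero q mq, zero s ms]; ring

theorem sum_side_eq_indicator [DecidablePred (· ∈ B)] (S : Splitting B k) (c : S.Cell)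
    {p : GridPoint n} (hp : p ∉ S.cellBag c) :
    ∑ a ∈ S.arcs c, S.side a p = if p ∈ B then 1 else 0 := by
  split_ifs with h
  · exact S.sum_side c p h hp
  · exact sum_eq_zero fun a _ => S.side_eq_zero a p h

/-- Around a cell, potentials of the crossings with a fixed side add up to that side, up to
a constant. -/
theorem exists_sum_potential_eq (hk : 2 * k < n) (hB : ∀ p, p ∈ B' ↔ p ∉ B)
    (S : Splitting B k) (S' : Splitting B' k) (c : S.Cell) (b : S'.Arc)
    (g : S.Arc → GridPoint n → ZMod 2)
    (hg : ∀ a, ∀ p ∈ freePoints (S.arcBag a ∪ S'.arcBag b),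
      ∀ q ∈ freePoints (S.arcBag a ∪ S'.arcBag b), AxisStep p q →
      g a p + g a q = S.side a p * S'.side b q + S'.side b p * S.side a q) :
    ∃ l : ZMod 2, ∀ p ∈ freePoints (S.cellBag c ∪ S'.arcBag b),
      ∑ a ∈ S.arcs c, g a p = S'.side b p + l := by
  classical
  have two := zmod_two_two
  have hcard : (S.cellBag c ∪ S'.arcBag b).ncard < n := by
    have h1 := Set.ncard_union_le (S.cellBag c) (S'.arcBag b)
    have h2 := S.ncard_cellBag_le c
    have h3 := S'.ncard_arcBag_le b
    omega
  obtain ⟨l, hl⟩ := eq_of_forall_axisStep hcard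
    (fun p => ∑ a ∈ S.arcs c, g a p + S'.side b p) (by
      intro p hp q hq hpq
      have hp' := notMem_of_mem_freePoints hp
      have hq' := notMem_of_mem_freePoints hq
      simp only [Set.mem_union, not_or] at hp' hq'
      have e : ∑ a ∈ S.arcs c, g a p + ∑ a ∈ S.arcs c, g a q =
          (∑ a ∈ S.arcs c, S.side a p) * S'.side b q +
            S'.side b p * ∑ a ∈ S.arcs c, S.side a q := by
        rw [← sum_add_distrib, sum_mul, mul_sum, ← sum_add_distrib]
        refine sum_congr rfl fun a ha => ?_
        have hsub := freePoints_anti (Set.union_subset_union_left (S'.arcBag b)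
          (S.arcBag_subset c a ha))
        exact hg a p (hsub hp) q (hsub hq) hpq
      rw [S.sum_side_eq_indicator c hp'.1, S.sum_side_eq_indicator c hq'.1] at e
      -- When p and q both lie in `B'`, the left side is 0 and the right side cancels because both
      -- have the same side of `b`.
      have e' : (if p ∈ B then 1 else 0) * S'.side b q + S'.side b p * (if q ∈ B then 1 else 0) =
          S'.side b p + S'.side b q := by
        by_cases mp : p ∈ B <;> by_cases mq : q ∈ B
        · simp [mp, mq, S'.side_eq_zero b p fun h => (hB p).1 h mp]
        · simp [mp, mq, S'.side_eq_zero b p fun h => (hB p).1 h mp]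
        · simp [mp, mq, S'.side_eq_zero b q fun h => (hB q).1 h mq]
        · simp only [mp, mq, if_false]
          rw [S'.side_congr b p ((hB p).2 mp) q ((hB q).2 mq) hp'.2 hq'.2 hpq.ascends]
          linear_combination - S'.side b q * two
      linear_combination e + e' - (∑ a ∈ S.arcs c, g a q - S'.side b p) * two)
  refine ⟨l, fun p hp => ?_⟩
  linear_combination hl p hp - S'.side b p * two

/-- Complementary parts of a large grid do not both have splittings with small bags. -/
theorem false_of_compl (hk : 2 * k < n) (hB : ∀ p, p ∈ B' ↔ p ∉ B)
    (S : Splitting B k) (S' : Splitting B' k) : False := by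
  classical
  have hB' : ∀ p, p ∈ B ↔ p ∉ B' := fun p => by simp [hB p]
  have hg : ∀ (a : S.Arc) (b : S'.Arc), ∃ g : GridPoint n → ZMod 2,
      ∀ p ∈ freePoints (S.arcBag a ∪ S'.arcBag b),
      ∀ q ∈ freePoints (S.arcBag a ∪ S'.arcBag b), AxisStep p q →
      g p + g q = S.side a p * S'.side b q + S'.side b p * S.side a q := fun a b => by
    refine exists_potential ?_ _ (crossing_additive hB S S' a b)
    have h1 := Set.ncard_union_le (S.arcBag a) (S'.arcBag b)
    have h2 := S.ncard_arcBag_le a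
    have h3 := S'.ncard_arcBag_le b
    omega
  choose g hg using hg
  have hl := fun c b => exists_sum_potential_eq hk hB S S' c b (fun a => g a b) fun a => hg a b
  have hm := fun c a => exists_sum_potential_eq hk hB' S' S c a (fun b => g a b) fun b p hp q hq h => by
    rw [Set.union_comm] at hp hq
    rw [hg a b p hp q hq h]
    ring
  choose l hl using hl
  choose m hm using hm
  have key : ∀ c c', ∑ b ∈ S'.arcs c', l c b + ∑ a ∈ S.arcs c, m c' a = 1 := by
    intro c c'
    have hcard : (S.cellBag c ∪ S'.cellBag c').ncard < n := by
      have h1 := Set.ncard_union_le (S.cellBag c) (S'.cellBag c')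
      have h2 := S.ncard_cellBag_le c
      have h3 := S'.ncard_cellBag_le c'
      omega
    obtain ⟨p, hp⟩ := freePoints_nonempty hcard
    have hp' := notMem_of_mem_freePoints hp
    simp only [Set.mem_union, not_or] at hp'
    have e1 : ∑ b ∈ S'.arcs c', ∑ a ∈ S.arcs c, g a b p =
        ∑ b ∈ S'.arcs c', S'.side b p + ∑ b ∈ S'.arcs c', l c b := by
      rw [← sum_add_distrib]
      refine sum_congr rfl fun b hb => hl c b p ?_
      exact freePoints_anti (Set.union_subset_union_right _ (S'.arcBag_subset c' b hb)) hp
    have e2 : ∑ a ∈ S.arcs c, ∑ b ∈ S'.arcs c', g a b p =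
        ∑ a ∈ S.arcs c, S.side a p + ∑ a ∈ S.arcs c, m c' a := by
      rw [← sum_add_distrib]
      refine sum_congr rfl fun a ha => hm c' a p ?_
      rw [Set.union_comm]
      exact freePoints_anti (Set.union_subset_union_left _ (S.arcBag_subset c a ha)) hp
    rw [sum_comm, e2, S.sum_side_eq_indicator c hp'.1, S'.sum_side_eq_indicator c' hp'.2] at e1
    have e3 : (if p ∈ B then (1 : ZMod 2) else 0) + (if p ∈ B' then 1 else 0) = 1 := by
      by_cases h : p ∈ B <;> simp [h, hB p]
    linear_combination e3 - e1 + (∑ a ∈ S.arcs c, m c' a - if p ∈ B' then 1 else 0) * zmod_two_two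
  have total : ∑ c : S.Cell, ∑ c' : S'.Cell,
      (∑ b ∈ S'.arcs c', l c b + ∑ a ∈ S.arcs c, m c' a) = 1 := by
    simp only [key, sum_const, card_univ, nsmul_eq_mul, S.odd_card, S'.odd_card, mul_one]
  simp only [sum_add_distrib, S'.even_incidence, zero_add] at total
  rw [sum_comm] at total
  simp only [S.even_incidence, sum_const_zero] at total
  exact zero_ne_one total

end Splitting

/-! ### The two sides of a tree edge -/

namespace SimpleGraph.IsTree

variable {N : Type*} {T : SimpleGraph N}

theorem not_reachable_deleteEdges (hT : T.IsTree) (d : T.Dart) :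
    ¬ (T.deleteEdges {d.edge}).Reachable d.fst d.snd :=
  isBridge_iff.1 (isAcyclic_iff_forall_adj_isBridge.1 hT.isAcyclic d.adj)

/-- Steps of a tree that do not leave the head side of a dart along that dart stay on it. -/
theorem reachable_of_adj (d : T.Dart) {x y : N} (hxy : T.Adj x y)
    (hx : (T.deleteEdges {d.edge}).Reachable d.snd x) :
    (T.deleteEdges {d.edge}).Reachable d.snd y ∨ s(x, y) = d.edge := by
  by_cases h : s(x, y) = d.edge
  · exact Or.inr h
  · exact Or.inl (hx.trans (Adj.reachable (by simp [deleteEdges_adj, hxy, h])))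

theorem reachable_symm_iff (hT : T.IsTree) (d : T.Dart) (x : N) :
    (T.deleteEdges {d.edge}).Reachable d.fst x ↔
      ¬ (T.deleteEdges {d.edge}).Reachable d.snd x := by
  constructor
  · exact fun h h' => hT.not_reachable_deleteEdges d (h.trans h'.symm)
  · intro h
    obtain ⟨w⟩ := hT.connected.preconnected x d.fst
    by_contra h'
    -- A walk starting outside both components never enters either, so it cannot end at the tail.
    have key : ∀ y z : N, T.Walk y z → ¬ (T.deleteEdges {d.edge}).Reachable d.fst y →
        ¬ (T.deleteEdges {d.edge}).Reachable d.snd y → z ≠ d.fst := by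
      intro y z p
      induction p with
      | nil => rintro h1 _ rfl; exact h1 (Reachable.refl _)
      | @cons a b c hab p ih =>
        intro h1 h2
        refine ih (fun h3 => ?_) fun h3 => ?_
        · rcases reachable_of_adj d.symm hab.symm (by simpa using h3) with h4 | h4
          · exact h1 (by simpa using h4)
          · rw [Dart.edge_symm] at h4
            rcases Sym2.eq_iff.1 h4 with ⟨_, rfl⟩ | ⟨rfl, rfl⟩
            · exact h2 (Reachable.refl _)
            · exact h1 (Reachable.refl _)
        · rcases reachable_of_adj d hab.symm h3 with h4 | h4
          · exact h2 h4
          · rcases Sym2.eq_iff.1 h4 with ⟨_, rfl⟩ | ⟨_, rfl⟩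
            · exact h2 (Reachable.refl _)
            · exact h1 (Reachable.refl _)
    exact key _ _ w h' h rfl

/-- From a node, exactly one dart points towards another given node. -/
theorem existsUnique_dart (hT : T.IsTree) {u x : N} (hux : u ≠ x) :
    ∃! d : T.Dart, d.fst = u ∧ (T.deleteEdges {d.edge}).Reachable d.snd x := by
  classical
  obtain ⟨p, hp, -⟩ := hT.existsUnique_path u x
  cases p with
  | nil => exact absurd rfl hux
  | @cons _ v _ huv p =>
    rw [Walk.cons_isPath_iff] at hp
    refine ⟨⟨(u, v), huv⟩, ⟨rfl, ?_⟩, ?_⟩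
    · refine ⟨p.toDeleteEdge _ fun h => hp.2 ?_⟩
      exact p.fst_mem_support_of_mem_edges h
    · rintro ⟨⟨u', v'⟩, hadj⟩ ⟨rfl, h⟩
      obtain ⟨q, hq⟩ := h.exists_isPath
      simp only [Dart.edge_mk] at q hq
      let q' : T.Walk v' x := q.mapLe (deleteEdges_le _)
      -- Returning to the tail would connect both ends of the deleted bridge. Thus the dart begins
      -- the unique path to x.
      have hu : u' ∉ q'.support := by
        intro hu
        rw [Walk.support_mapLe_eq_support] at hu
        exact hT.not_reachable_deleteEdges ⟨(u', v'), hadj⟩ (q.takeUntil u' hu).reachable.symm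
      have hq' : (Walk.cons hadj q').IsPath := by
        rw [Walk.cons_isPath_iff]
        exact ⟨hq.mapLe _, hu⟩
      have hp' : (Walk.cons huv p).IsPath := by rwa [Walk.cons_isPath_iff]
      have := (hT.isAcyclic.subsingleton_path _ _).elim ⟨_, hq'⟩ ⟨_, hp'⟩
      simp only [Subtype.mk.injEq, Walk.cons.injEq] at this
      obtain ⟨rfl, -⟩ := this
      rfl

/-- A connected set of nodes with nodes on both sides of a dart contains both ends of the dart. -/
theorem reachable_iff_of_connected (d : T.Dart) {s : Set N} (hs : (T.induce s).Connected)
    (hd : ¬ (d.fst ∈ s ∧ d.snd ∈ s)) {x y : N} (hx : x ∈ s) (hy : y ∈ s) :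
    (T.deleteEdges {d.edge}).Reachable d.snd x ↔ (T.deleteEdges {d.edge}).Reachable d.snd y := by
  have key : ∀ a b : s, (T.induce s).Walk a b →
      (T.deleteEdges {d.edge}).Reachable (a : N) (b : N) := by
    intro a b w
    induction w with
    | nil => exact Reachable.refl _
    | @cons a b c hab w ih =>
      refine Reachable.trans (Adj.reachable ?_) ih
      have hab' : T.Adj a b := hab
      refine deleteEdges_adj.2 ⟨hab', fun h => hd ?_⟩
      rcases Sym2.eq_iff.1 (Set.mem_singleton_iff.1 h) with ⟨h1, h2⟩ | ⟨h1, h2⟩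
      · exact ⟨h1 ▸ a.2, h2 ▸ b.2⟩
      · exact ⟨h2 ▸ b.2, h1 ▸ a.2⟩
  obtain ⟨w⟩ := hs.preconnected ⟨x, hx⟩ ⟨y, hy⟩
  have h := key _ _ w
  exact ⟨fun h' => h'.trans h, fun h' => h'.trans h.symm⟩

end SimpleGraph.IsTree

/-! ### From tree decompositions to splittings -/

theorem Ascends.eq_or_adj {n : ℕ} {p q : GridPoint n} (h : Ascends p q) :
    p = q ∨ (diagonalCubeGrid n).Adj p q := by
  by_cases hpq : p = q
  · exact Or.inl hpq
  · exact Or.inr ((SimpleGraph.fromRel_adj _ _ _).2 ⟨hpq, Or.inl h⟩)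

theorem TreeDecomposition.ncard_bag_le {V : Type} {G : SimpleGraph V} (D : TreeDecomposition G)
    {t : ℕ} (hD : D.width ≤ t) (u : D.Node) : (D.bag u).ncard ≤ t + 1 := by
  have h : (D.bag u).ncard ≤ Finset.univ.sup fun u : D.Node => (D.bag u).ncard :=
    Finset.le_sup (f := fun u : D.Node => (D.bag u).ncard) (mem_univ u)
  simp only [TreeDecomposition.width] at hD
  omega

open Classical in
/-- The splitting of a set of grid points that comes from a tree decomposition of a larger set. -/
noncomputable def TreeDecomposition.splitting {n t : ℕ} {W B : Set (GridPoint n)} (hBW : B ⊆ W)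
    (D : TreeDecomposition ((diagonalCubeGrid n).induce W)) (hD : D.width ≤ t) :
    Splitting B (t + 1) :=
  -- Choose a home node for every point of `W`, with a junk value elsewhere; a point is behind a
  -- dart when its home is.
  have hr : ∃ r : GridPoint n → D.Node, ∀ p (hp : p ∈ W), ⟨p, hp⟩ ∈ D.bag (r p) := by
    have := D.isTree.connected.nonempty
    have h : ∀ p, ∃ u, ∀ hp : p ∈ W, ⟨p, hp⟩ ∈ D.bag u := fun p => by
      by_cases hp : p ∈ W
      · obtain ⟨u, hu⟩ := D.vertex_mem ⟨p, hp⟩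
        exact ⟨u, fun _ => hu⟩
      · exact ⟨Classical.arbitrary _, fun h => absurd h hp⟩
    exact ⟨fun p => (h p).choose, fun p => (h p).choose_spec⟩
  let edgeBag : Sym2 D.Node → Set (GridPoint n) := fun e => Subtype.val '' {w | ∀ u ∈ e, w ∈ D.bag u}
  have edgeBag_subset : ∀ e : Sym2 D.Node, ∀ u ∈ e, edgeBag e ⊆ Subtype.val '' D.bag u :=
    fun e u hu => Set.image_mono fun w hw => hw u hu
  have hbag : ∀ u, (Subtype.val '' D.bag u).ncard ≤ t + 1 := fun u =>
    (Set.ncard_image_le (Set.toFinite _)).trans (D.ncard_bag_le hD u)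
  have hedge : ∀ e, (edgeBag e).ncard ≤ t + 1 := fun e => by
    induction e with
    | _ u v =>
      exact (Set.ncard_le_ncard (edgeBag_subset _ u (Sym2.mem_mk_left u v)) (Set.toFinite _)).trans
        (hbag u)
  let behind : D.tree.Dart → GridPoint n → Prop := fun d p =>
    (D.tree.deleteEdges {d.edge}).Reachable d.snd (hr.choose p)
  { Cell := D.Node ⊕ D.tree.edgeSet
    Arc := D.tree.Dart
    arcs := Sum.elim (fun u => univ.filter fun d => d.fst = u)
      (fun e => univ.filter fun d => (⟨d.edge, d.edge_mem⟩ : D.tree.edgeSet) = e)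
    odd_card := by
      have h := D.isTree.card_edgeFinset
      rw [SimpleGraph.edgeFinset_card] at h
      rw [Fintype.card_sum, ← h]
      push_cast
      linear_combination (Fintype.card D.tree.edgeSet : ZMod 2) * zmod_two_two
    even_incidence := fun f => by
      rw [Fintype.sum_sum_type]
      simp only [Sum.elim_inl, Sum.elim_inr]
      have h1 : ∑ u, ∑ d : D.tree.Dart with d.fst = u, f d = ∑ d, f d := by
        convert sum_fiberwise univ (fun d : D.tree.Dart => d.fst) f
      rw [h1, sum_fiberwise]
      linear_combination (∑ d, f d) * zmod_two_two
    cellBag := Sum.elim (fun u => Subtype.val '' D.bag u) fun e => edgeBag e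
    arcBag := fun d => edgeBag d.edge
    ncard_cellBag_le := by
      rintro (u | e)
      · exact hbag u
      · exact hedge e
    ncard_arcBag_le := fun d => hedge _
    arcBag_subset := by
      rintro (u | e) d hd
      · simp only [Sum.elim_inl, mem_filter, mem_univ, true_and] at hd
        exact edgeBag_subset _ _ (hd ▸ Sym2.mem_mk_left d.fst d.snd)
      · simp only [Sum.elim_inr, mem_filter, mem_univ, true_and] at hd
        rw [← hd]
        exact subset_rfl
    side := fun d p => if p ∈ B ∧ behind d p then 1 else 0
    side_eq_zero := fun d p hp => if_neg fun h => hp h.1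
    sum_side := by
      rintro (u | ⟨e, he⟩) p hp hpc
      · have hu : u ≠ hr.choose p := by
          rintro rfl
          exact hpc ⟨⟨p, hBW hp⟩, hr.choose_spec p (hBW hp), rfl⟩
        obtain ⟨d, ⟨hd1, hd2⟩, hd3⟩ := D.isTree.existsUnique_dart hu
        rw [Sum.elim_inl, sum_eq_single d]
        · exact if_pos ⟨hp, hd2⟩
        · intro d' hd' hne
          refine if_neg fun h => hne (hd3 d' ⟨(mem_filter.1 hd').2, h.2⟩)
        · intro h
          exact absurd (by simp [hd1]) h
      · obtain ⟨d, rfl⟩ : ∃ d : D.tree.Dart, d.edge = e := by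
          induction e with
          | _ u v => exact ⟨⟨(u, v), he⟩, rfl⟩
        have hfib : (univ.filter fun d' : D.tree.Dart =>
            (⟨d'.edge, d'.edge_mem⟩ : D.tree.edgeSet) = ⟨d.edge, he⟩) = {d, d.symm} := by
          rw [← d.edge_fiber]
          simp
        have hiff := D.isTree.reachable_symm_iff d (hr.choose p)
        rw [Sum.elim_inr, hfib, sum_pair d.symm_ne.symm]
        simp only [behind, SimpleGraph.Dart.edge_symm, hp, true_and]
        change _ + (if (D.tree.deleteEdges {d.edge}).Reachable d.fst (hr.choose p) then _ else _) = _
        rw [if_congr hiff rfl rfl]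
        by_cases h : (D.tree.deleteEdges {d.edge}).Reachable d.snd (hr.choose p) <;> simp [h]
    side_congr := by
      intro d p hp q hq hpd hqd hpq
      -- Off the edge bag, the subtree of v misses an end of the edge, so it lies on one side. The
      -- subtrees of adjacent p and q share a node, so the sides agree.
      have out : ∀ v (hv : v ∈ W), v ∉ edgeBag d.edge →
          ¬ (d.fst ∈ {u | (⟨v, hv⟩ : W) ∈ D.bag u} ∧ d.snd ∈ {u | (⟨v, hv⟩ : W) ∈ D.bag u}) := by
        rintro v hv hvd ⟨h1, h2⟩
        refine hvd ⟨⟨v, hv⟩, fun u hu => ?_, rfl⟩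
        rcases Sym2.mem_iff.1 hu with rfl | rfl
        · exact h1
        · exact h2
      rcases hpq.eq_or_adj with rfl | hadj
      · rfl
      · obtain ⟨u, hu1, hu2⟩ := D.edge_mem ⟨p, hBW hp⟩ ⟨q, hBW hq⟩ hadj
        have e1 := SimpleGraph.IsTree.reachable_iff_of_connected d (D.connected ⟨p, hBW hp⟩)
          (out p (hBW hp) hpd) (hr.choose_spec p (hBW hp)) hu1
        have e2 := SimpleGraph.IsTree.reachable_iff_of_connected d (D.connected ⟨q, hBW hq⟩)
          (out q (hBW hq) hqd) (hr.choose_spec q (hBW hq)) hu2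
        exact if_congr (by simp only [hp, hq, true_and, behind, e1, e2]) rfl rfl }

theorem mainTheorem4 :
    ¬ TreewidthFragile diagonalCubeGridClass ∧
    ¬ TreewidthFragileFor diagonalCubeGridClass 2 ∧
    ∀ t : ℕ, ∃ N : ℕ, ∀ n : ℕ, N ≤ n →
      ¬ ∃ A₁ A₂ : Set (Fin n × Fin n × Fin n), Disjoint A₁ A₂ ∧
        treewidth ((diagonalCubeGrid n).induce A₁ᶜ) ≤ (t : ℤ) ∧
        treewidth ((diagonalCubeGrid n).induce A₂ᶜ) ≤ (t : ℤ) := by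
  -- Bags have at most t + 1 points and two of them must total fewer than n, whence 2(t + 1) + 1.
  have main : ∀ t n : ℕ, 2 * t + 3 ≤ n →
      ¬ ∃ A₁ A₂ : Set (Fin n × Fin n × Fin n), Disjoint A₁ A₂ ∧
        treewidth ((diagonalCubeGrid n).induce A₁ᶜ) ≤ (t : ℤ) ∧
        treewidth ((diagonalCubeGrid n).induce A₂ᶜ) ≤ (t : ℤ) := by
    rintro t n hn ⟨A₁, A₂, hA, h₁, h₂⟩
    obtain ⟨D₁, hD₁⟩ := (treewidth_le_iff _ _).1 h₁
    obtain ⟨D₂, hD₂⟩ := (treewidth_le_iff _ _).1 h₂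
    exact Splitting.false_of_compl (by omega) (fun p => (Set.notMem_compl_iff (s := A₁)).symm)
      (D₁.splitting subset_rfl hD₁) (D₂.splitting hA.subset_compl_right hD₂)
  have two : ¬ TreewidthFragileFor diagonalCubeGridClass 2 := by
    rintro ⟨t, ht⟩
    obtain ⟨A, hA, hw⟩ := ht _ (diagonalCubeGrid (2 * t + 3))
      ⟨2 * t + 3, by omega, ⟨SimpleGraph.Iso.refl⟩⟩
    exact main t _ le_rfl ⟨A 0, A 1, hA 0 1 (by decide), hw 0, hw 1⟩
  exact ⟨fun h => two (h 2 (by omega)), two, fun t => ⟨2 * t + 3, main t⟩⟩
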